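/- For integers $p\ge 0$, $k\in\{-1,0,\dots,p-1\}$ and $n\ge 1$ let $$S_{p,k,n}=\{s\in C^k([0,1]) : s|_{[j/n,(j+1)/n)} \text{ is a polynomial of degree at most } p,\ j=0,\dots,n-1\},$$ where $k=-1$ means that no continuity is required at the breakpoints, and let $\Pi_{p,k,n}$ be the $L^2(0,1)$-orthogonal projection onto $S_{p,k,n}$. For $0\le q\le p$ let $C^{(q)}_{p,k,n}$ be the smallest real number such that $$\|f-\Pi_{p,k,n}f\|_{L^2(0,1)}\le C^{(q)}_{p,k,n}\,\|\partial^{q+1}f\|_{L^2(0,1)}\qquad\text{for all } f\in H^{q+1}(0,1),$$ where all functions are real-valued and $\partial^{q+1}f$ is the weak derivative. Theorem. For all $0\le q\le p$, $k\in\{-1,0,\dots,p-1\}$ and $n\ge 1$, this smallest number exists and $$C^{(q)}_{p,k,n}\le\Big(\frac{1}{n\pi}\Big)^{q+1}.$$ -/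

import Mathlib

open MeasureTheory Set Polynomial
open scoped ContDiff

noncomputable section

namespace SplineApprox

/-- Lebesgue measure on the open unit interval `(0,1)`. -/
abbrev unitMeasure : Measure ℝ := volume.restrict (Ioo (0 : ℝ) 1)

/-- The real Hilbert space `L²(0,1)`. -/
abbrev L2 : Type := Lp ℝ 2 unitMeasure

/-- `g ∈ L²(0,1)` is the weak derivative of order `m` of `f ∈ L²(0,1)`. Test functions are the
smooth functions on the line with compact support contained in `(0,1)`. -/
def HasWeakDeriv (m : ℕ) (f g : L2) : Prop :=
  ∀ φ : ℝ → ℝ, ContDiff ℝ ∞ φ → HasCompactSupport φ → tsupport φ ⊆ Ioo (0 : ℝ) 1 →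
    ∫ x in Ioo (0 : ℝ) 1, f x * iteratedDeriv m φ x
      = (-1 : ℝ) ^ m * ∫ x in Ioo (0 : ℝ) 1, g x * φ x

/-- The Sobolev space `H^m(0,1)`: all weak derivatives of order at most `m` exist in `L²(0,1)`. -/
def sobolevH (m : ℕ) : Set L2 :=
  {f | ∀ j ≤ m, ∃ g : L2, HasWeakDeriv j f g}

/-- The segment `I_j = [j/n, (j+1)/n)`. -/
def segment (n j : ℕ) : Set ℝ := Ico ((j : ℝ) / n) (((j : ℝ) + 1) / n)

/-- `s` is a spline of degree `p` and smoothness `k` on `n` uniform segments of `[0,1]`: it is of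
class `C^k` on `[0,1]` and a polynomial of degree at most `p` on each segment.
For `k = -1` there is no condition across the breakpoints. -/
def IsSpline (p : ℕ) (k : ℤ) (n : ℕ) (s : ℝ → ℝ) : Prop :=
  (∀ r : ℕ, (r : ℤ) ≤ k → ContDiffOn ℝ r s (Icc (0 : ℝ) 1)) ∧
    ∀ j < n, ∃ P : ℝ[X], P.natDegree ≤ p ∧ ∀ x ∈ segment n j, s x = P.eval x

/-- The spline space `S_{p,k,n}` as a subspace of `L²(0,1)`. -/
def splineSpace (p : ℕ) (k : ℤ) (n : ℕ) : Submodule ℝ L2 where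
  carrier := {F | ∃ s : ℝ → ℝ, IsSpline p k n s ∧ F =ᵐ[unitMeasure] s}
  zero_mem' := by
    refine ⟨fun _ => 0, ⟨fun r _ => contDiffOn_const, fun j _ => ⟨0, by simp, by simp⟩⟩, ?_⟩
    exact Lp.coeFn_zero ℝ 2 unitMeasure
  add_mem' := by
    rintro F G ⟨s, hs, hF⟩ ⟨t, ht, hG⟩
    refine ⟨fun x => s x + t x, ⟨fun r hr => (hs.1 r hr).add (ht.1 r hr), fun j hj => ?_⟩, ?_⟩
    · obtain ⟨P, hP, hPs⟩ := hs.2 j hj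
      obtain ⟨Q, hQ, hQt⟩ := ht.2 j hj
      exact ⟨P + Q, natDegree_add_le_of_degree_le hP hQ, fun x hx => by
        simp [hPs x hx, hQt x hx]⟩
    · filter_upwards [Lp.coeFn_add F G, hF, hG] with x h1 h2 h3
      exact h1.trans (by rw [Pi.add_apply, h2, h3])
  smul_mem' := by
    rintro c F ⟨s, hs, hF⟩
    refine ⟨fun x => c * s x, ⟨fun r hr => contDiffOn_const.mul (hs.1 r hr), fun j hj => ?_⟩, ?_⟩
    · obtain ⟨P, hP, hPs⟩ := hs.2 j hj
      exact ⟨C c * P, (natDegree_C_mul_le c P).trans hP, fun x hx => by simp [hPs x hx]⟩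
    · filter_upwards [Lp.coeFn_smul c F, hF] with x h1 h2
      simp [h1, h2]

/-- The span of the monomials of degree at most `p` truncated to the segments. -/
def pieceSpan (p n : ℕ) : Submodule ℝ (ℝ → ℝ) :=
  Submodule.span ℝ (Set.range fun a : Fin n × Fin (p + 1) =>
    (segment n a.1).indicator fun x : ℝ => x ^ (a.2 : ℕ))

theorem memLp_of_mem_pieceSpan {p n : ℕ} {f : ℝ → ℝ} (hf : f ∈ pieceSpan p n) :
    MemLp f 2 unitMeasure := by
  induction hf using Submodule.span_induction with
  | mem f h =>
    obtain ⟨a, rfl⟩ := h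
    refine MemLp.indicator measurableSet_Ico (MemLp.of_bound (by fun_prop) 1 ?_)
    refine (ae_restrict_iff' measurableSet_Ioo).2 (Filter.Eventually.of_forall fun x hx => ?_)
    rw [norm_pow, Real.norm_eq_abs, abs_of_pos hx.1]
    exact pow_le_one₀ hx.1.le hx.2.le
  | zero => exact MemLp.zero
  | add f g _ _ hf hg => exact hf.add hg
  | smul c f _ hf => exact hf.const_smul c

/-- The class in `L²(0,1)` of a truncated polynomial combination. -/
def pieceToL2 (p n : ℕ) : pieceSpan p n →ₗ[ℝ] L2 where
  toFun f := (memLp_of_mem_pieceSpan f.2).toLp f.1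
  map_add' _ _ := rfl
  map_smul' _ _ := rfl

theorem exists_mem_segment {n : ℕ} (hn : 0 < n) {x : ℝ} (hx : x ∈ Ioo (0 : ℝ) 1) :
    ∃ j < n, x ∈ segment n j := by
  have hn' : (0 : ℝ) < n := by exact_mod_cast hn
  have h0 : 0 ≤ x * n := mul_nonneg hx.1.le hn'.le
  refine ⟨⌊x * n⌋₊, (Nat.floor_lt h0).2 (by nlinarith [hx.2]), ?_, ?_⟩
  · rw [div_le_iff₀ hn']
    exact Nat.floor_le h0
  · rw [lt_div_iff₀ hn']
    exact Nat.lt_floor_add_one _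

theorem segment_unique {n i j : ℕ} (hn : 0 < n) {x : ℝ} (hi : x ∈ segment n i)
    (hj : x ∈ segment n j) : i = j := by
  have hn' : (0 : ℝ) < n := by exact_mod_cast hn
  obtain ⟨h1, h2⟩ := hi
  obtain ⟨h3, h4⟩ := hj
  rw [div_le_iff₀ hn'] at h1 h3
  rw [lt_div_iff₀ hn'] at h2 h4
  have h5 : (i : ℝ) < j + 1 := by linarith
  have h6 : (j : ℝ) < i + 1 := by linarith
  have h7 : i < j + 1 := by exact_mod_cast h5
  have h8 : j < i + 1 := by exact_mod_cast h6
  omega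

theorem splineSpace_le_range {p : ℕ} {k : ℤ} {n : ℕ} (hn : 0 < n) :
    splineSpace p k n ≤ LinearMap.range (pieceToL2 p n) := by
  rintro F ⟨s, hs, hF⟩
  choose P hP hPs using fun j : Fin n => hs.2 j j.2
  let t : ℝ → ℝ := ∑ j : Fin n, ∑ i : Fin (p + 1),
    (P j).coeff i • (segment n j).indicator fun x : ℝ => x ^ (i : ℕ)
  have ht : t ∈ pieceSpan p n := Submodule.sum_mem _ fun j _ => Submodule.sum_mem _ fun i _ =>
    Submodule.smul_mem _ _ (Submodule.subset_span ⟨(j, i), rfl⟩)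
  refine ⟨⟨t, ht⟩, Lp.ext ?_⟩
  have hmem : ∀ᵐ x ∂unitMeasure, x ∈ Ioo (0 : ℝ) 1 := ae_restrict_mem measurableSet_Ioo
  filter_upwards [(memLp_of_mem_pieceSpan ht).coeFn_toLp, hF, hmem] with x h1 h2 hx
  refine h1.trans (Eq.trans ?_ h2.symm)
  obtain ⟨j, hj, hxj⟩ := exists_mem_segment hn hx
  simp only [t, Finset.sum_apply, Pi.smul_apply]
  rw [Finset.sum_eq_single (⟨j, hj⟩ : Fin n)]
  · rw [hPs ⟨j, hj⟩ x hxj, eval_eq_sum_range' (Nat.lt_succ_of_le (hP ⟨j, hj⟩)),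
      Finset.sum_range]
    simp [indicator_of_mem hxj]
  · intro i _ hi
    have hxi : x ∉ segment n i := fun h => hi (Fin.ext (segment_unique hn h hxj))
    simp [indicator_of_notMem hxi]
  · simp

instance finiteDimensional_splineSpace (p : ℕ) (k : ℤ) (n : ℕ) [NeZero n] :
    FiniteDimensional ℝ (splineSpace p k n) := by
  have : FiniteDimensional ℝ (pieceSpan p n) :=
    FiniteDimensional.span_of_finite ℝ (Set.finite_range _)
  exact Submodule.finiteDimensional_of_le (splineSpace_le_range (NeZero.pos n))

/-- The orthogonal projection of `L²(0,1)` onto the spline space `S_{p,k,n}`. -/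
def splineProj (p : ℕ) (k : ℤ) (n : ℕ) [NeZero n] : L2 →L[ℝ] L2 :=
  (splineSpace p k n).starProjection

/-- The real numbers `c` such that `‖f - Π f‖ ≤ c ‖∂^{q+1} f‖` for all `f ∈ H^{q+1}(0,1)`, where
`Π` is the orthogonal projection onto `S_{p,k,n}`. -/
def admissibleConstants (p : ℕ) (k : ℤ) (n q : ℕ) [NeZero n] : Set ℝ :=
  {c | ∀ f ∈ sobolevH (q + 1), ∀ g : L2, HasWeakDeriv (q + 1) f g →
    ‖f - splineProj p k n f‖ ≤ c * ‖g‖}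

/-- The best constant `C^{(q)}_{p,k,n}`. -/
def bestConstant (p : ℕ) (k : ℤ) (n q : ℕ) [NeZero n] : ℝ :=
  sInf (admissibleConstants p k n q)

end SplineApprox

end

/-!
Let `K u (x) = ∫₀ˣ u` be the Volterra operator on `L²(0,1)`, let `P_p` be the orthogonal projection
onto the splines of degree `p` and maximal smoothness `p - 1`, and put `C = 1 / (n π)`. Smoother
splines form a smaller space (`splineSpace_anti`) and the projection is the best approximation, so it
suffices to bound the error of `P_p`, that is, the case `k = p - 1`.

The heart of the matter is the operator bound `‖(1 - P_p) K‖ ≤ C` for every `p`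
(`norm_volterra_sub_splineProj_le`). By the integration by parts `inner_volterra_right`, `K` is
skew-adjoint on functions with mean zero. As `K` maps splines of degree `p` to splines of degree
`p + 1` (`volterra_mem_splineSpace_succ`),
`(1 - P_{p+1}) K = (1 - P_{p+1}) K (1 - P_p)`, whose adjoint is `-(1 - P_p) K (1 - P_{p+1})`; hence
the norm does not increase with `p`. For `p = 0` the adjoint is `-K (1 - P_0)`: the primitive of a
function orthogonal to the piecewise constants vanishes at all breakpoints, so the sharp
Dirichlet inequality `integral_sq_le_integral_deriv_sq` on each segment of length `1 / n` gives the
bound `C` (`norm_volterra_le`).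

By the du Bois-Reymond lemma (`HasWeakDeriv.exists_eq_const_add_volterra`), `f` is a constant plus
`K f'`. Since `P_{p+1}` reproduces constants and `K P_p f'`, the error of `f` is the error of
`K (f' - P_p f')`, at most `C ‖f' - P_p f'‖`. Induction on `q` yields the power `C ^ (q + 1)`
(`norm_sub_splineProj_le_of_hasWeakDeriv`).

The admissible constants thus form a nonempty set. It is closed, and it is bounded below by zero
because the derivative of order `q + 1` of the `(q + 1)`-fold primitive of `1` does not vanish; so
its infimum is attained (`isLeast_bestConstant`).
-/

namespace SplineApprox

/-! ### The sharp Dirichlet inequality on an interval -/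

/-- Riccati form of the Dirichlet inequality: `ψ = -l tan (l (x - m))`, with `m` the midpoint,
satisfies `ψ' = -l² - ψ²` on all of `[a, b]`, so `F'² - l² F²` is the square `(F' - ψ F)²` plus
the derivative of `ψ F²`, which integrates to zero. -/
theorem mul_integral_sq_le_integral_deriv_sq_of_lt {a b l : ℝ} (hab : a < b) (hl : 0 < l)
    (hlb : l * (b - a) < Real.pi) {F : ℝ → ℝ} (hF : AbsolutelyContinuousOnInterval F a b)
    (ha : F a = 0) (hb : F b = 0)
    (hi : IntervalIntegrable (fun x => deriv F x ^ 2) volume a b) :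
    l ^ 2 * ∫ x in a..b, F x ^ 2 ≤ ∫ x in a..b, deriv F x ^ 2 := by
  let m : ℝ := (a + b) / 2
  let ψ : ℝ → ℝ := fun x => -l * Real.tan (l * (x - m))
  -- the bound on `l` keeps `l (x - m)` inside `(-π/2, π/2)`
  have hcos : ∀ x ∈ Icc a b, Real.cos (l * (x - m)) ≠ 0 := by
    intro x hx
    apply (Real.cos_pos_of_mem_Ioo _).ne'
    simp only [m]
    constructor <;> nlinarith [hx.1, hx.2]
  have hψ : ∀ x ∈ Icc a b, HasDerivAt ψ (-l ^ 2 - ψ x ^ 2) x := by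
    intro x hx
    have h1 : HasDerivAt (fun x : ℝ => l * (x - m)) (l * 1) x :=
      ((hasDerivAt_id x).sub_const m).const_mul l
    have h2 := ((Real.hasDerivAt_tan (hcos x hx)).comp x h1).const_mul (-l)
    refine h2.congr_deriv ?_
    have h3 := hcos x hx
    have h4 := Real.sin_sq_add_cos_sq (l * (x - m))
    simp only [ψ, Real.tan_eq_sin_div_cos]
    field_simp
    linear_combination h4
  have hψac : AbsolutelyContinuousOnInterval ψ a b := by
    apply ContDiffOn.absolutelyContinuousOnInterval
    rw [uIcc_of_le hab.le]
    intro x hx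
    apply ContDiffAt.contDiffWithinAt
    refine contDiffAt_const.mul 
      ((Real.contDiffAt_tan.2 (hcos x hx)).comp x (f := fun x : ℝ => l * (x - m)) ?_)
    fun_prop
  have hG : AbsolutelyContinuousOnInterval (fun x => ψ x * F x ^ 2) a b := by
    have := hψac.mul (hF.mul hF)
    refine Eq.subst (motive := fun G => AbsolutelyContinuousOnInterval G a b) ?_ this
    ext x
    simp [sq]
  have hFc : IntervalIntegrable (fun x => F x ^ 2) volume a b :=
    (hF.continuousOn.pow 2).intervalIntegrable
  have hG0 := hG.integral_deriv_eq_sub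
  rw [ha, hb] at hG0
  have hnn : 0 ≤ ∫ x in a..b, (deriv F x ^ 2 - l ^ 2 * F x ^ 2) -
      deriv (fun x => ψ x * F x ^ 2) x := by
    apply intervalIntegral.integral_nonneg_of_ae_restrict hab.le
    rw [Filter.EventuallyLE, ae_restrict_iff' measurableSet_Icc]
    filter_upwards [hF.ae_differentiableAt] with x hx hxI
    have h1 := (hx (by rwa [uIcc_of_le hab.le])).hasDerivAt
    have h2 := (hψ x hxI).mul (h1.pow 2)
    have h3 : deriv (fun x => ψ x * F x ^ 2) x = _ := h2.deriv
    rw [h3]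
    simp only [Pi.zero_apply, Pi.pow_apply]
    have : 0 ≤ (deriv F x - ψ x * F x) ^ 2 := sq_nonneg _
    push_cast
    nlinarith [this]
  rw [intervalIntegral.integral_sub (hi.sub (hFc.const_mul _)) hG.intervalIntegrable_deriv,
    intervalIntegral.integral_sub hi (hFc.const_mul _), intervalIntegral.integral_const_mul,
    hG0] at hnn
  linarith

/-- The Dirichlet inequality with the sharp constant, by letting `l` increase to `π / (b - a)`. -/
theorem integral_sq_le_integral_deriv_sq {a b : ℝ} (hab : a < b)
    {F : ℝ → ℝ} (hF : AbsolutelyContinuousOnInterval F a b)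
    (ha : F a = 0) (hb : F b = 0)
    (hi : IntervalIntegrable (fun x => deriv F x ^ 2) volume a b) :
    ∫ x in a..b, F x ^ 2 ≤ ((b - a) / Real.pi) ^ 2 * ∫ x in a..b, deriv F x ^ 2 := by
  have hba : 0 < b - a := sub_pos.2 hab
  have hL : 0 < Real.pi / (b - a) := div_pos Real.pi_pos hba
  have key : (Real.pi / (b - a)) ^ 2 * ∫ x in a..b, F x ^ 2 ≤ ∫ x in a..b, deriv F x ^ 2 := by
    have ht : Filter.Tendsto (fun l : ℝ => l ^ 2 * ∫ x in a..b, F x ^ 2)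
        (nhdsWithin (Real.pi / (b - a)) (Iio (Real.pi / (b - a))))
        (nhds ((Real.pi / (b - a)) ^ 2 * ∫ x in a..b, F x ^ 2)) :=
      (Continuous.tendsto (by fun_prop) _).mono_left nhdsWithin_le_nhds
    refine le_of_tendsto ht ?_
    filter_upwards [Ioo_mem_nhdsLT hL] with l hl
    exact mul_integral_sq_le_integral_deriv_sq_of_lt hab hl.1 ((lt_div_iff₀ hba).1 hl.2) hF ha hb hi
  calc ∫ x in a..b, F x ^ 2
      = ((b - a) / Real.pi) ^ 2 * ((Real.pi / (b - a)) ^ 2 * ∫ x in a..b, F x ^ 2) := by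
        have := Real.pi_pos.ne'
        field_simp
    _ ≤ _ := mul_le_mul_of_nonneg_left key (sq_nonneg _)

/-! ### Primitives of integrable functions -/

/-- The primitive of `u` that vanishes at `0`. -/
noncomputable def primitive (u : ℝ → ℝ) (x : ℝ) : ℝ := ∫ t in (0 : ℝ)..x, u t

theorem unitMeasure_eq_Ioc : unitMeasure = volume.restrict (Ioc (0 : ℝ) 1) :=
  Measure.restrict_congr_set Ioo_ae_eq_Ioc

theorem integral_unitMeasure (f : ℝ → ℝ) :
    ∫ x in Ioo (0 : ℝ) 1, f x = ∫ x in (0 : ℝ)..1, f x := by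
  rw [intervalIntegral.integral_of_le zero_le_one, ← unitMeasure_eq_Ioc]

theorem intervalIntegrable_of_integrable {f : ℝ → ℝ} (hf : Integrable f unitMeasure) :
    IntervalIntegrable f volume 0 1 := by
  rw [unitMeasure_eq_Ioc] at hf
  exact (intervalIntegrable_iff_integrableOn_Ioc_of_le zero_le_one).2 hf

theorem intervalIntegrable_coe (u : L2) : IntervalIntegrable u volume 0 1 :=
  intervalIntegrable_of_integrable ((Lp.memLp u).integrable one_le_two)

theorem intervalIntegrable_sq_coe (u : L2) :
    IntervalIntegrable (fun x => u x ^ 2) volume 0 1 :=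
  intervalIntegrable_of_integrable (Lp.memLp u).integrable_sq

theorem primitive_zero (u : ℝ → ℝ) : primitive u 0 = 0 := intervalIntegral.integral_same

theorem absolutelyContinuous_primitive {u : ℝ → ℝ} (hu : IntervalIntegrable u volume 0 1) :
    AbsolutelyContinuousOnInterval (primitive u) 0 1 :=
  hu.absolutelyContinuousOnInterval_intervalIntegral left_mem_uIcc

theorem continuousOn_primitive {u : ℝ → ℝ} (hu : IntervalIntegrable u volume 0 1) :
    ContinuousOn (primitive u) (Icc 0 1) := by
  rw [← uIcc_of_le (zero_le_one (α := ℝ))]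
  exact (absolutelyContinuous_primitive hu).continuousOn

theorem ae_deriv_primitive {u : ℝ → ℝ} (hu : IntervalIntegrable u volume 0 1) :
    ∀ᵐ x, x ∈ Icc (0 : ℝ) 1 → deriv (primitive u) x = u x := by
  filter_upwards [hu.ae_hasDerivAt_integral] with x hx hxI
  exact (hx (by rwa [uIcc_of_le zero_le_one]) 0 left_mem_uIcc).deriv

theorem primitive_congr_ae {u v : ℝ → ℝ} (h : u =ᵐ[unitMeasure] v) {x : ℝ}
    (hx : x ∈ Icc (0 : ℝ) 1) : primitive u x = primitive v x := by
  unfold primitive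
  rw [intervalIntegral.integral_of_le hx.1, intervalIntegral.integral_of_le hx.1]
  rw [unitMeasure_eq_Ioc] at h
  exact integral_congr_ae (ae_restrict_of_ae_restrict_of_subset (Ioc_subset_Ioc_right hx.2) h)

theorem memLp_of_continuousOn {f : ℝ → ℝ} (hf : ContinuousOn f (Icc 0 1)) :
    MemLp f 2 unitMeasure := by
  obtain ⟨C, hC⟩ := isCompact_Icc.exists_bound_of_continuousOn hf
  refine MemLp.of_bound ((hf.mono Ioo_subset_Icc_self).aestronglyMeasurable measurableSet_Ioo) C ?_
  exact (ae_restrict_iff' measurableSet_Ioo).2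
    (Filter.Eventually.of_forall fun x hx => hC x (Ioo_subset_Icc_self hx))

theorem memLp_primitive {u : ℝ → ℝ} (hu : IntervalIntegrable u volume 0 1) :
    MemLp (primitive u) 2 unitMeasure :=
  memLp_of_continuousOn (continuousOn_primitive hu)

/-- Integration by parts on `[0,1]`; both primitives vanish at `0`. -/
theorem integral_mul_primitive_add {u v : ℝ → ℝ} (hu : IntervalIntegrable u volume 0 1)
    (hv : IntervalIntegrable v volume 0 1) :
    (∫ x in (0 : ℝ)..1, u x * primitive v x) + ∫ x in (0 : ℝ)..1, primitive u x * v x =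
      primitive u 1 * primitive v 1 := by
  have hU := absolutelyContinuous_primitive hu
  have hV := absolutelyContinuous_primitive hv
  have h := hU.integral_deriv_mul_eq_sub hV
  rw [primitive_zero, zero_mul, sub_zero] at h
  rw [← intervalIntegral.integral_add (hu.mul_continuousOn hV.continuousOn)
    (hv.continuousOn_mul hU.continuousOn), ← h]
  apply intervalIntegral.integral_congr_ae
  filter_upwards [ae_deriv_primitive hu, ae_deriv_primitive hv] with x h1 h2 hx
  rw [uIoc_of_le zero_le_one] at hx
  rw [h1 (Ioc_subset_Icc_self hx), h2 (Ioc_subset_Icc_self hx)]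


/-! ### The Volterra operator on `L²(0,1)` -/

theorem inner_eq_integral (f g : L2) : inner ℝ f g = ∫ x in (0 : ℝ)..1, f x * g x := by
  rw [L2.inner_def, integral_unitMeasure]
  exact intervalIntegral.integral_congr fun x _ => mul_comm _ _

theorem norm_sq_eq_integral (f : L2) : ‖f‖ ^ 2 = ∫ x in (0 : ℝ)..1, f x ^ 2 := by
  rw [← real_inner_self_eq_norm_sq, inner_eq_integral]
  exact intervalIntegral.integral_congr fun x _ => (sq _).symm

theorem integral_congr_unit {f g : ℝ → ℝ} (h : f =ᵐ[unitMeasure] g) :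
    ∫ x in (0 : ℝ)..1, f x = ∫ x in (0 : ℝ)..1, g x := by
  rw [← integral_unitMeasure, ← integral_unitMeasure]
  exact integral_congr_ae h

/-- The Volterra operator `u ↦ ∫₀ˣ u` on `L²(0,1)`. -/
noncomputable def volterra (u : L2) : L2 := (memLp_primitive (intervalIntegrable_coe u)).toLp _

theorem coeFn_volterra (u : L2) : volterra u =ᵐ[unitMeasure] primitive u :=
  MemLp.coeFn_toLp _

theorem ae_mem_Ioo : ∀ᵐ x ∂unitMeasure, x ∈ Ioo (0 : ℝ) 1 := ae_restrict_mem measurableSet_Ioo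

theorem primitive_sub_coe (u v : L2) {x : ℝ} (hx : x ∈ Icc (0 : ℝ) 1) :
    primitive ↑(u - v) x = primitive u x - primitive v x := by
  rw [primitive_congr_ae (Lp.coeFn_sub u v) hx]
  have hs : uIcc 0 x ⊆ uIcc (0 : ℝ) 1 := by
    rw [uIcc_of_le hx.1, uIcc_of_le zero_le_one]
    exact Icc_subset_Icc_right hx.2
  exact intervalIntegral.integral_sub ((intervalIntegrable_coe u).mono_set hs)
    ((intervalIntegrable_coe v).mono_set hs)

theorem volterra_sub (u v : L2) : volterra (u - v) = volterra u - volterra v := by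
  apply Lp.ext
  filter_upwards [coeFn_volterra (u - v), coeFn_volterra u, coeFn_volterra v,
    Lp.coeFn_sub (volterra u) (volterra v), ae_mem_Ioo] with x h1 h2 h3 h4 hx
  rw [h1, h4, Pi.sub_apply, h2, h3, primitive_sub_coe u v (Ioo_subset_Icc_self hx)]

/-- On functions with mean zero the Volterra operator is skew-adjoint. -/
theorem inner_volterra_right {e : L2} (he : primitive e 1 = 0) (u : L2) :
    inner ℝ e (volterra u) = -inner ℝ (volterra e) u := by
  have h := integral_mul_primitive_add (intervalIntegrable_coe e) (intervalIntegrable_coe u)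
  rw [he, zero_mul] at h
  have h1 : inner ℝ e (volterra u) = ∫ x in (0 : ℝ)..1, e x * primitive u x := by
    rw [inner_eq_integral]
    exact integral_congr_unit ((coeFn_volterra u).mono fun x hx => by simp only [hx])
  have h2 : inner ℝ (volterra e) u = ∫ x in (0 : ℝ)..1, primitive e x * u x := by
    rw [inner_eq_integral]
    exact integral_congr_unit ((coeFn_volterra e).mono fun x hx => by simp only [hx])
  linarith

/-- If the primitive of `e` vanishes at all breakpoints, the Dirichlet inequality on each segment
bounds it with the constant `1 / (n π)`. -/
theorem norm_volterra_le {n : ℕ} (hn : 0 < n) {e : L2}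
    (he : ∀ j ≤ n, primitive e ((j : ℝ) / n) = 0) :
    ‖volterra e‖ ≤ 1 / (n * Real.pi) * ‖e‖ := by
  have hn' : (0 : ℝ) < n := by exact_mod_cast hn
  have hC : (0 : ℝ) ≤ 1 / (n * Real.pi) := by positivity
  let a : ℕ → ℝ := fun j => (j : ℝ) / n
  have ha0 : a 0 = 0 := by simp [a]
  have han : a n = 1 := div_self hn'.ne'
  have hsub : ∀ j < n, uIcc (a j) (a (j + 1)) ⊆ uIcc 0 1 := by
    intro j hj
    have h1 : a j ≤ a (j + 1) := by simp only [a]; gcongr; simp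
    have h2 : a (j + 1) ≤ 1 := by
      rw [← han]; simp only [a]; gcongr; exact hj
    rw [uIcc_of_le h1, uIcc_of_le zero_le_one]
    exact Icc_subset_Icc (by positivity) h2
  have hAC := absolutelyContinuous_primitive (intervalIntegrable_coe e)
  have hder := ae_deriv_primitive (intervalIntegrable_coe e)
  have hFi : IntervalIntegrable (fun x => primitive e x ^ 2) volume 0 1 :=
    (hAC.continuousOn.pow 2).intervalIntegrable
  have hei := intervalIntegrable_sq_coe e
  have hseg : ∀ j < n, ∫ x in a j..a (j + 1), primitive e x ^ 2 ≤
      (1 / (n * Real.pi)) ^ 2 * ∫ x in a j..a (j + 1), e x ^ 2 := by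
    intro j hj
    have hlt : a j < a (j + 1) := by simp only [a]; gcongr; simp
    have hae : ∀ᵐ x, x ∈ uIoc (a j) (a (j + 1)) → deriv (primitive e) x ^ 2 = e x ^ 2 := by
      filter_upwards [hder] with x hx hxI
      rw [hx]
      rw [← uIcc_of_le (zero_le_one (α := ℝ))]
      exact hsub j hj (uIoc_subset_uIcc hxI)
    have hint : IntervalIntegrable (fun x => deriv (primitive e) x ^ 2) volume
        (a j) (a (j + 1)) := by
      refine (hei.mono_set (hsub j hj)).congr_ae ?_
      rw [Filter.EventuallyEq, ae_restrict_iff' measurableSet_uIoc]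
      filter_upwards [hae] with x hx hxI using (hx hxI).symm
    have h := integral_sq_le_integral_deriv_sq hlt (hAC.mono (hsub j hj)) (he j hj.le)
      (he (j + 1) hj) hint
    rw [intervalIntegral.integral_congr_ae hae] at h
    have hlen : (a (j + 1) - a j) / Real.pi = 1 / (n * Real.pi) := by
      simp only [a]
      push_cast
      field_simp
      ring
    rwa [hlen] at h
  have hsum : ‖volterra e‖ ^ 2 ≤ (1 / (n * Real.pi) * ‖e‖) ^ 2 := by
    have h1 : ‖volterra e‖ ^ 2 = ∫ x in a 0..a n, primitive e x ^ 2 := by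
      rw [norm_sq_eq_integral, ha0, han]
      exact integral_congr_unit ((coeFn_volterra e).mono fun x hx => by simp only [hx])
    have h2 : ‖e‖ ^ 2 = ∫ x in a 0..a n, e x ^ 2 := by
      rw [norm_sq_eq_integral, ha0, han]
    rw [mul_pow, h1, h2,
      ← intervalIntegral.sum_integral_adjacent_intervals fun j hj => hFi.mono_set (hsub j hj),
      ← intervalIntegral.sum_integral_adjacent_intervals fun j hj => hei.mono_set (hsub j hj),
      Finset.mul_sum]
    exact Finset.sum_le_sum fun j hj => hseg j (Finset.mem_range.1 hj)
  exact le_of_sq_le_sq hsum (mul_nonneg hC (norm_nonneg _))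

/-! ### Spline spaces -/

theorem splineSpace_anti (p n : ℕ) {k l : ℤ} (h : k ≤ l) :
    splineSpace p l n ≤ splineSpace p k n := by
  rintro F ⟨s, hs, hF⟩
  exact ⟨s, ⟨fun r hr => hs.1 r (hr.trans h), hs.2⟩, hF⟩

theorem const_mem_splineSpace (p : ℕ) (k : ℤ) (n : ℕ) (c : ℝ) :
    Lp.const 2 unitMeasure c ∈ splineSpace p k n :=
  ⟨fun _ => c, ⟨fun _ _ => contDiffOn_const, fun _ _ => ⟨C c, by simp, by simp⟩⟩,
    Lp.coeFn_const ..⟩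

theorem exists_derivative_eq (P : ℝ[X]) :
    ∃ Q : ℝ[X], derivative Q = P ∧ Q.natDegree ≤ P.natDegree + 1 := by
  refine ⟨∑ i ∈ Finset.range (P.natDegree + 1), monomial (i + 1) (P.coeff i / (i + 1)), ?_, ?_⟩
  · conv_rhs => rw [P.as_sum_range]
    rw [derivative_sum]
    refine Finset.sum_congr rfl fun i _ => ?_
    rw [derivative_monomial]
    have : (i : ℝ) + 1 ≠ 0 := by positivity
    congr 1
    push_cast
    field_simp
  · refine natDegree_sum_le_of_forall_le _ _ fun i hi => (natDegree_monomial_le _).trans ?_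
    exact Nat.succ_le_succ (Nat.lt_succ_iff.1 (Finset.mem_range.1 hi))

theorem hasDerivWithinAt_primitive {s : ℝ → ℝ} (hs : ContinuousOn s (Icc 0 1)) {x : ℝ}
    (hx : x ∈ Icc (0 : ℝ) 1) : HasDerivWithinAt (primitive s) (s x) (Icc 0 1) x := by
  let g : ℝ → ℝ := IccExtend zero_le_one ((Icc (0 : ℝ) 1).domRestrict s)
  have hg : Continuous g := hs.domRestrict.Icc_extend'
  have hgs : ∀ y ∈ Icc (0 : ℝ) 1, g y = s y := fun y hy => IccExtend_of_mem _ _ hy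
  have h := (hg.integral_hasStrictDerivAt 0 x).hasDerivAt.hasDerivWithinAt (s := Icc 0 1)
  rw [hgs x hx] at h
  have heq : ∀ y ∈ Icc (0 : ℝ) 1, primitive s y = ∫ t in (0 : ℝ)..y, g t := by
    intro y hy
    refine intervalIntegral.integral_congr fun t ht => (hgs t ?_).symm
    rw [uIcc_of_le hy.1] at ht
    exact ⟨ht.1, ht.2.trans hy.2⟩
  exact h.congr heq (heq x hx)

/-- Integration raises both the degree and the smoothness of a spline by one. -/
theorem IsSpline.primitive {p n : ℕ} {k : ℤ} {s : ℝ → ℝ} (hs : IsSpline p k n s)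
    (hi : IntervalIntegrable s volume 0 1) :
    IsSpline (p + 1) (k + 1) n (primitive s) := by
  refine ⟨fun r hr => ?_, fun j hj => ?_⟩
  · rcases r with _ | r
    · exact contDiffOn_zero.2 (continuousOn_primitive hi)
    · have hrk : (r : ℤ) ≤ k := by push_cast at hr; linarith
      have hd := fun x hx => hasDerivWithinAt_primitive (hs.1 r hrk).continuousOn (x := x) hx
      have hu : UniqueDiffOn ℝ (Icc (0 : ℝ) 1) := uniqueDiffOn_Icc zero_lt_one
      push_cast
      refine (contDiffOn_succ_iff_derivWithin hu).2
        ⟨fun x hx => (hd x hx).differentiableWithinAt, by simp, ?_⟩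
      exact (hs.1 r hrk).congr fun x hx => (hd x hx).derivWithin (hu x hx)
  · obtain ⟨P, hP, hPs⟩ := hs.2 j hj
    obtain ⟨Q, hQ, hQd⟩ := exists_derivative_eq P
    have hn : (0 : ℝ) < n := by exact_mod_cast (Nat.zero_le j).trans_lt hj
    set a : ℝ := (j : ℝ) / n with ha
    refine ⟨Q + C (SplineApprox.primitive s a - Q.eval a), ?_, fun x hx => ?_⟩
    · rw [natDegree_add_C]
      omega
    · have ha0 : 0 ≤ a := by positivity
      have hx1 : x ≤ 1 := by
        refine hx.2.le.trans ((div_le_one hn).2 ?_)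
        exact_mod_cast hj
      have hax : a ≤ x := hx.1
      have hsub1 : uIcc 0 a ⊆ uIcc (0 : ℝ) 1 := by
        rw [uIcc_of_le ha0, uIcc_of_le zero_le_one]
        exact Icc_subset_Icc_right (hax.trans hx1)
      have hsub2 : uIcc a x ⊆ uIcc (0 : ℝ) 1 := by
        rw [uIcc_of_le hax, uIcc_of_le zero_le_one]
        exact Icc_subset_Icc ha0 hx1
      have h1 : SplineApprox.primitive s x =
          SplineApprox.primitive s a + ∫ t in a..x, s t :=
        (intervalIntegral.integral_add_adjacent_intervals (hi.mono_set hsub1)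
          (hi.mono_set hsub2)).symm
      have h2 : ∫ t in a..x, s t = ∫ t in a..x, P.eval t := by
        refine intervalIntegral.integral_congr fun t ht => hPs t ?_
        rw [uIcc_of_le hax] at ht
        exact ⟨ht.1, ht.2.trans_lt hx.2⟩
      have h3 : ∫ t in a..x, P.eval t = Q.eval x - Q.eval a := by
        refine intervalIntegral.integral_eq_sub_of_hasDerivAt (f := fun t => Q.eval t) (fun t _ => ?_)
          (P.continuous.intervalIntegrable _ _)
        have := Q.hasDerivAt t
        rwa [hQ] at this
      rw [h1, h2, h3, eval_add, eval_C]
      ring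

theorem volterra_mem_splineSpace {p n : ℕ} {k : ℤ} {u : L2} (hu : u ∈ splineSpace p k n) :
    volterra u ∈ splineSpace (p + 1) (k + 1) n := by
  obtain ⟨s, hs, hus⟩ := hu
  have hi : IntervalIntegrable s volume 0 1 :=
    intervalIntegrable_of_integrable (((Lp.memLp u).integrable one_le_two).congr hus)
  refine ⟨primitive s, hs.primitive hi, ?_⟩
  filter_upwards [coeFn_volterra u, ae_mem_Ioo] with x hx hxI
  rw [hx, primitive_congr_ae hus (Ioo_subset_Icc_self hxI)]

/-- A function orthogonal to the piecewise constants has a primitive that vanishes at all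
breakpoints. -/
theorem primitive_eq_zero_of_orthogonal {n : ℕ} (hn : 0 < n) {e : L2}
    (he : ∀ s ∈ splineSpace 0 (-1) n, inner ℝ s e = 0) {j : ℕ} (hj : j ≤ n) :
    primitive e ((j : ℝ) / n) = 0 := by
  have hn' : (0 : ℝ) < n := by exact_mod_cast hn
  set b : ℝ := (j : ℝ) / n with hb
  have hb0 : 0 ≤ b := by positivity
  have hb1 : b ≤ 1 := (div_le_one hn').2 (by exact_mod_cast hj)
  -- test against the indicator function of `[0, b)`, a piecewise constant spline
  have hm : MemLp ((Iio b).indicator fun _ => (1 : ℝ)) 2 unitMeasure :=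
    (memLp_const 1).indicator measurableSet_Iio
  have hmem : hm.toLp _ ∈ splineSpace 0 (-1) n := by
    refine ⟨_, ⟨fun r hr => absurd hr (by omega), fun i _ => ?_⟩, hm.coeFn_toLp⟩
    by_cases hij : i < j
    · refine ⟨1, by simp, fun x hx => ?_⟩
      have : x < b := hx.2.trans_le (by rw [hb]; gcongr; exact_mod_cast hij)
      simp [this]
    · refine ⟨0, by simp, fun x hx => ?_⟩
      have : b ≤ x := le_trans (by rw [hb]; gcongr; omega) hx.1
      simp [this]
  have h := he _ hmem
  rw [inner_eq_integral] at h
  have h1 : ∫ x in (0 : ℝ)..1, hm.toLp _ x * e x =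
      ∫ x in (0 : ℝ)..1, (Iio b).indicator (fun _ => (1 : ℝ)) x * e x :=
    integral_congr_unit (hm.coeFn_toLp.mono fun x hx => by simp only [hx])
  rw [h1, ← integral_unitMeasure] at h
  have h2 : (fun x => (Iio b).indicator (fun _ => (1 : ℝ)) x * e x) = (Iio b).indicator e := by
    ext x
    by_cases hx : x ∈ Iio b <;> simp [hx]
  have h3 : Ioo (0 : ℝ) 1 ∩ Iio b = Ioo 0 b := by
    ext x
    simp only [mem_inter_iff, mem_Ioo, mem_Iio]
    exact ⟨fun h => ⟨h.1.1, h.2⟩, fun h => ⟨⟨h.1, h.2.trans_le hb1⟩, h.2⟩⟩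
  rw [h2, setIntegral_indicator measurableSet_Iio, h3] at h
  rw [primitive, intervalIntegral.integral_of_le hb0, integral_Ioc_eq_integral_Ioo, h]


/-! ### Weak derivatives -/

/-- A test function: smooth with compact support contained in `(0,1)`. -/
structure IsTest (φ : ℝ → ℝ) : Prop where
  contDiff : ContDiff ℝ ∞ φ
  hasCompactSupport : HasCompactSupport φ
  tsupport_subset : tsupport φ ⊆ Ioo (0 : ℝ) 1

theorem IsTest.deriv {φ : ℝ → ℝ} (h : IsTest φ) : IsTest (deriv φ) :=
  ⟨(contDiff_infty_iff_deriv.1 h.contDiff).2, h.hasCompactSupport.deriv,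
    (closure_minimal support_deriv_subset (isClosed_tsupport φ)).trans h.tsupport_subset⟩

theorem IsTest.iteratedDeriv {φ : ℝ → ℝ} (h : IsTest φ) (m : ℕ) : IsTest (iteratedDeriv m φ) := by
  induction m with
  | zero => rwa [iteratedDeriv_zero]
  | succ m ih =>
    rw [iteratedDeriv_succ]
    exact ih.deriv

theorem IsTest.eq_zero {φ : ℝ → ℝ} (h : IsTest φ) {x : ℝ} (hx : x ∉ Ioo (0 : ℝ) 1) : φ x = 0 :=
  image_eq_zero_of_notMem_tsupport fun hx' => hx (h.tsupport_subset hx')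

theorem IsTest.primitive_deriv {φ : ℝ → ℝ} (h : IsTest φ) (x : ℝ) :
    primitive (_root_.deriv φ) x = φ x := by
  have h1 := intervalIntegral.integral_deriv_eq_sub (f := φ) (a := 0) (b := x)
    (fun y _ => (contDiff_infty_iff_deriv.1 h.contDiff).1 y)
    (h.deriv.contDiff.continuous.intervalIntegrable _ _)
  rw [primitive, h1, h.eq_zero (x := 0) (by simp), sub_zero]

theorem IsTest.sub_const_mul {φ ψ : ℝ → ℝ} (hφ : IsTest φ) (hψ : IsTest ψ) (c : ℝ) :
    IsTest fun x => φ x - c * ψ x := by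
  have hsupp : tsupport (fun x => φ x - c * ψ x) ⊆ tsupport φ ∪ tsupport ψ := by
    refine closure_minimal (fun x hx => ?_) ((isClosed_tsupport φ).union (isClosed_tsupport ψ))
    by_contra hcon
    rw [mem_union, not_or] at hcon
    apply hx
    simp [image_eq_zero_of_notMem_tsupport hcon.1, image_eq_zero_of_notMem_tsupport hcon.2]
  refine ⟨hφ.contDiff.sub (contDiff_const.mul hψ.contDiff), ?_,
    hsupp.trans (union_subset hφ.tsupport_subset hψ.tsupport_subset)⟩
  exact (hφ.hasCompactSupport.union hψ.hasCompactSupport).of_isClosed_subset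
    (isClosed_tsupport _) hsupp

/-- The primitive of a test function with mean zero is a test function. -/
theorem IsTest.primitive {φ : ℝ → ℝ} (h : IsTest φ) (h1 : primitive φ 1 = 0) :
    IsTest (primitive φ) := by
  have hd : ∀ x, HasDerivAt (SplineApprox.primitive φ) (φ x) x := fun x =>
    (h.contDiff.continuous.integral_hasStrictDerivAt 0 x).hasDerivAt
  -- outside a compact interval containing the support of `φ` the primitive vanishes
  obtain ⟨α, β, hα, hβ, hsupp⟩ : ∃ α β : ℝ, 0 < α ∧ β < 1 ∧ tsupport φ ⊆ Icc α β := by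
    rcases (tsupport φ).eq_empty_or_nonempty with he | hne
    · exact ⟨1, 0, one_pos, one_pos, by simp [he]⟩
    · obtain ⟨α, hα⟩ := h.hasCompactSupport.isCompact.exists_isLeast hne
      obtain ⟨β, hβ⟩ := h.hasCompactSupport.isCompact.exists_isGreatest hne
      exact ⟨α, β, (h.tsupport_subset hα.1).1, (h.tsupport_subset hβ.1).2,
        fun x hx => ⟨hα.2 hx, hβ.2 hx⟩⟩
  have hz : ∀ x ∉ Icc α β, φ x = 0 := fun x hx =>
    image_eq_zero_of_notMem_tsupport fun hx' => hx (hsupp hx')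
  have hts : tsupport (SplineApprox.primitive φ) ⊆ Icc α β := by
    refine closure_minimal (fun x hx => ?_) isClosed_Icc
    by_contra hcon
    apply hx
    rw [mem_Icc, not_and_or, not_le, not_le] at hcon
    rcases hcon with hcon | hcon
    · refine (intervalIntegral.integral_congr (g := fun _ => 0) fun t ht => ?_).trans (by simp)
      refine hz t fun ht' => ?_
      have := ht.2.trans_lt (max_lt hα hcon)
      linarith [ht'.1]
    · have h2 : ∫ t in x..1, φ t = 0 := by
        refine (intervalIntegral.integral_congr (g := fun _ => 0) fun t ht => ?_).trans (by simp)
        refine hz t fun ht' => ?_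
        have := (lt_min hcon hβ).trans_le ht.1
        linarith [ht'.2]
      have hc := h.contDiff.continuous
      have h3 := intervalIntegral.integral_add_adjacent_intervals (μ := volume)
        (hc.intervalIntegrable 0 x) (hc.intervalIntegrable x 1)
      unfold SplineApprox.primitive at h1 ⊢
      linarith
  refine ⟨?_, isCompact_Icc.of_isClosed_subset (isClosed_tsupport _) hts,
    hts.trans fun x hx => ⟨hα.trans_le hx.1, hx.2.trans_lt hβ⟩⟩
  rw [contDiff_infty_iff_deriv]
  refine ⟨fun x => (hd x).differentiableAt, ?_⟩
  have : _root_.deriv (SplineApprox.primitive φ) = φ := funext fun x => (hd x).deriv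
  rw [this]
  exact h.contDiff

theorem integral_mul_deriv_eq_of_primitive {u φ : ℝ → ℝ} (hu : IntervalIntegrable u volume 0 1)
    (hφ : IsTest φ) :
    ∫ x in (0 : ℝ)..1, primitive u x * deriv φ x = -∫ x in (0 : ℝ)..1, u x * φ x := by
  have h := integral_mul_primitive_add hu (hφ.deriv.contDiff.continuous.intervalIntegrable 0 1)
  rw [hφ.primitive_deriv, hφ.eq_zero (x := 1) (by simp), mul_zero] at h
  have h1 : ∫ x in (0 : ℝ)..1, u x * primitive (deriv φ) x = ∫ x in (0 : ℝ)..1, u x * φ x :=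
    intervalIntegral.integral_congr fun x _ => by simp only [hφ.primitive_deriv]
  linarith

theorem hasWeakDeriv_zero (f : L2) : HasWeakDeriv 0 f f := fun φ _ _ _ => by simp

theorem HasWeakDeriv.volterra {m : ℕ} {u g : L2} (h : HasWeakDeriv m u g) :
    HasWeakDeriv (m + 1) (volterra u) g := by
  intro φ h1 h2 h3
  have hφ : IsTest φ := ⟨h1, h2, h3⟩
  have h4 := h φ h1 h2 h3
  rw [integral_unitMeasure, integral_unitMeasure] at h4 ⊢
  have h5 : ∫ x in (0 : ℝ)..1, SplineApprox.volterra u x * iteratedDeriv (m + 1) φ x =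
      ∫ x in (0 : ℝ)..1, primitive u x * iteratedDeriv (m + 1) φ x :=
    integral_congr_unit ((coeFn_volterra u).mono fun x hx => by simp only [hx])
  rw [h5, iteratedDeriv_succ,
    integral_mul_deriv_eq_of_primitive (intervalIntegrable_coe u) (hφ.iteratedDeriv m), h4]
  ring

/-- The weak derivatives of the first weak derivative of `f` are those of `f`. -/
theorem HasWeakDeriv.of_succ {m : ℕ} {f f₁ g : L2} (h₁ : HasWeakDeriv 1 f f₁)
    (h : HasWeakDeriv (m + 1) f g) : HasWeakDeriv m f₁ g := by
  intro φ h1 h2 h3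
  have hφ := IsTest.iteratedDeriv ⟨h1, h2, h3⟩ m
  have h4 := h φ h1 h2 h3
  have h5 := h₁ _ hφ.contDiff hφ.hasCompactSupport hφ.tsupport_subset
  rw [iteratedDeriv_one, ← iteratedDeriv_succ, h4] at h5
  rw [pow_succ] at h5
  linarith

theorem exists_isTest_integral_eq_one : ∃ θ : ℝ → ℝ, IsTest θ ∧ ∫ x in (0 : ℝ)..1, θ x = 1 := by
  let b : ContDiffBump (1 / 2 : ℝ) := ⟨1 / 8, 1 / 4, by norm_num, by norm_num⟩
  have hsub : tsupport (b.normed volume) ⊆ Ioo 0 1 := by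
    rw [b.tsupport_normed_eq, Real.closedBall_eq_Icc]
    simp only [b]
    exact fun x hx => ⟨by linarith [hx.1], by linarith [hx.2]⟩
  refine ⟨b.normed volume, ⟨b.contDiff_normed, b.hasCompactSupport_normed, hsub⟩, ?_⟩
  rw [← integral_unitMeasure, setIntegral_eq_integral_of_forall_compl_eq_zero, b.integral_normed]
  exact fun x hx => image_eq_zero_of_notMem_tsupport fun hx' => hx (hsub hx')

theorem intervalIntegrable_mul_isTest (h : L2) {φ : ℝ → ℝ} (hφ : IsTest φ) :
    IntervalIntegrable (fun x => h x * φ x) volume 0 1 :=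
  (intervalIntegrable_coe h).mul_continuousOn hφ.contDiff.continuous.continuousOn

/-- The du Bois-Reymond lemma: `θ` is a fixed test function of integral one, and `φ - (∫ φ) θ` is
the derivative of a test function for every test function `φ`. -/
theorem exists_eq_const_of_integral_mul_deriv_eq_zero {h : L2}
    (hh : ∀ φ, IsTest φ → ∫ x in (0 : ℝ)..1, h x * deriv φ x = 0) :
    ∃ c : ℝ, h = Lp.const 2 unitMeasure c := by
  obtain ⟨θ, hθ, hθ1⟩ := exists_isTest_integral_eq_one
  set c := ∫ x in (0 : ℝ)..1, h x * θ x with hc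
  refine ⟨c, Lp.ext (Filter.EventuallyEq.trans ?_ (Lp.coeFn_const ..).symm)⟩
  have hint : Integrable (fun x => h x - c) unitMeasure :=
    ((Lp.memLp h).integrable one_le_two).sub (integrable_const c)
  have key := isOpen_Ioo.ae_eq_zero_of_integral_contDiff_smul_eq_zero (μ := volume)
    (U := Ioo (0 : ℝ) 1) (f := fun x => h x - c)
    (IntegrableOn.locallyIntegrableOn hint) fun φ h1 h2 h3 => by
      have hφ : IsTest φ := ⟨h1, h2, h3⟩
      set d := ∫ x in (0 : ℝ)..1, φ x with hd
      have hψ := hφ.sub_const_mul hθ d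
      have hφi : IntervalIntegrable φ volume 0 1 := h1.continuous.intervalIntegrable _ _
      have hθi : IntervalIntegrable θ volume 0 1 :=
        hθ.contDiff.continuous.intervalIntegrable _ _
      have hψ1 : primitive (fun x => φ x - d * θ x) 1 = 0 := by
        unfold primitive
        rw [intervalIntegral.integral_sub hφi (hθi.const_mul d),
          intervalIntegral.integral_const_mul, hθ1, ← hd]
        ring
      have h4 := hh _ (hψ.primitive hψ1)
      have h5 : deriv (primitive fun x => φ x - d * θ x) = fun x => φ x - d * θ x :=
        funext fun x => (hψ.contDiff.continuous.integral_hasStrictDerivAt 0 x).hasDerivAt.deriv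
      have h6 : (fun x => h x * (φ x - d * θ x)) = fun x => h x * φ x - d * (h x * θ x) := by
        ext x
        ring
      rw [h5, h6, intervalIntegral.integral_sub (intervalIntegrable_mul_isTest h hφ)
        ((intervalIntegrable_mul_isTest h hθ).const_mul d),
        intervalIntegral.integral_const_mul, ← hc] at h4
      have h7 : ∀ x, φ x • (h x - c) = h x * φ x - c * φ x := fun x => by
        rw [smul_eq_mul]
        ring
      rw [← setIntegral_eq_integral_of_forall_compl_eq_zero (s := Ioo (0 : ℝ) 1)
        fun x hx => by simp [hφ.eq_zero hx], integral_unitMeasure]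
      simp only [h7]
      rw [intervalIntegral.integral_sub (intervalIntegrable_mul_isTest h hφ) (hφi.const_mul c),
        intervalIntegral.integral_const_mul, ← hd]
      linarith
  rw [Filter.EventuallyEq, ae_restrict_iff' measurableSet_Ioo]
  filter_upwards [key] with x hx hxI
  exact sub_eq_zero.1 (hx hxI)

/-- A function with weak derivative `g ∈ L²(0,1)` is, up to a constant, the primitive of `g`. -/
theorem HasWeakDeriv.exists_eq_const_add_volterra {f g : L2} (h : HasWeakDeriv 1 f g) :
    ∃ c : ℝ, f = Lp.const 2 unitMeasure c + SplineApprox.volterra g := by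
  obtain ⟨c, hc⟩ := exists_eq_const_of_integral_mul_deriv_eq_zero
    (h := f - SplineApprox.volterra g) fun φ hφ => by
      have h1 := h φ hφ.contDiff hφ.hasCompactSupport hφ.tsupport_subset
      have h2 := integral_mul_deriv_eq_of_primitive (intervalIntegrable_coe g) hφ
      rw [iteratedDeriv_one, integral_unitMeasure, integral_unitMeasure] at h1
      have h3 : ∫ x in (0 : ℝ)..1, (f - SplineApprox.volterra g : L2) x * deriv φ x =
          ∫ x in (0 : ℝ)..1, (f x * deriv φ x - primitive g x * deriv φ x) := by
        apply integral_congr_unit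
        filter_upwards [Lp.coeFn_sub f (SplineApprox.volterra g), coeFn_volterra g] with x h4 h5
        rw [h4, Pi.sub_apply, h5, sub_mul]
      have hprim : IntervalIntegrable (primitive g) volume 0 1 :=
        (absolutelyContinuous_primitive (intervalIntegrable_coe g)).continuousOn.intervalIntegrable
      rw [h3, intervalIntegral.integral_sub (intervalIntegrable_mul_isTest f hφ.deriv)
        (hprim.mul_continuousOn hφ.deriv.contDiff.continuous.continuousOn), h1, h2]
      ring
  exact ⟨c, sub_eq_iff_eq_add.1 hc⟩

/-! ### The error estimate for splines of maximal smoothness -/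

theorem volterra_mem_splineSpace_succ {p n : ℕ} {u : L2} (hu : u ∈ splineSpace p ((p : ℤ) - 1) n) :
    volterra u ∈ splineSpace (p + 1) (((p + 1 : ℕ) : ℤ) - 1) n := by
  have := volterra_mem_splineSpace hu
  rwa [show ((p + 1 : ℕ) : ℤ) - 1 = (p : ℤ) - 1 + 1 by push_cast; ring]

variable {n : ℕ} [NeZero n]

theorem splineProj_mem (p : ℕ) (k : ℤ) (f : L2) : splineProj p k n f ∈ splineSpace p k n :=
  Submodule.starProjection_apply_mem _ f

theorem inner_sub_splineProj {p : ℕ} {k : ℤ} (f : L2) {s : L2} (hs : s ∈ splineSpace p k n) :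
    inner ℝ s (f - splineProj p k n f) = 0 :=
  (Submodule.mem_orthogonal _ _).1 (Submodule.sub_starProjection_mem_orthogonal f) s hs

theorem inner_sub_splineProj_left {p : ℕ} {k : ℤ} (f : L2) {s : L2} (hs : s ∈ splineSpace p k n) :
    inner ℝ (f - splineProj p k n f) s = 0 := by
  rw [real_inner_comm, inner_sub_splineProj f hs]

theorem norm_mul_self_sub_splineProj (p : ℕ) (k : ℤ) (f : L2) :
    ‖f - splineProj p k n f‖ * ‖f - splineProj p k n f‖ =
      inner ℝ (f - splineProj p k n f) f := by
  rw [← real_inner_self_eq_norm_mul_norm, inner_sub_right _ f,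
    inner_sub_splineProj_left f (splineProj_mem p k f), sub_zero]

theorem norm_sub_splineProj_le {p : ℕ} {k : ℤ} (f : L2) {s : L2} (hs : s ∈ splineSpace p k n) :
    ‖f - splineProj p k n f‖ ≤ ‖f - s‖ := by
  rw [splineProj, Submodule.starProjection_minimal]
  exact ciInf_le ⟨0, by rintro _ ⟨x, rfl⟩; exact norm_nonneg _⟩ (⟨s, hs⟩ : splineSpace p k n)

/-- The estimate for the residual `e` of a primitive, by induction on the degree. Since `e` has mean
zero, skew-adjointness of the Volterra operator `K` turns `‖e‖² = ⟨e, K u⟩` into `-⟨K e, u⟩`. In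
degree zero `K e` is bounded directly; in higher degree `u` may be replaced by its own residual,
which leaves only the residual of `K e` in one degree less. -/
theorem norm_volterra_sub_splineProj_le (p : ℕ) (u : L2) :
    ‖volterra u - splineProj p ((p : ℤ) - 1) n (volterra u)‖ ≤ 1 / (n * Real.pi) * ‖u‖ := by
  have hn := NeZero.pos n
  induction p generalizing u with
  | zero =>
    set e := volterra u - splineProj 0 (((0 : ℕ) : ℤ) - 1) n (volterra u) with he
    have horth : ∀ s ∈ splineSpace 0 (-1) n, inner ℝ s e = 0 := fun s hs =>
      inner_sub_splineProj (k := ((0 : ℕ) : ℤ) - 1) _ (by simpa using hs)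
    have hbr := fun j hj => primitive_eq_zero_of_orthogonal hn horth (j := j) hj
    have h1 : primitive e 1 = 0 := by
      have := hbr n le_rfl
      rwa [div_self (by exact_mod_cast hn.ne')] at this
    have h2 : ‖e‖ * ‖e‖ = -inner ℝ (volterra e) u := by
      rw [← inner_volterra_right h1]
      exact norm_mul_self_sub_splineProj _ _ _
    have h3 := norm_volterra_le hn hbr
    have h4 := neg_le_of_abs_le (abs_real_inner_le_norm (volterra e) u)
    rcases (norm_nonneg e).eq_or_lt with h0 | h0
    · rw [← h0]; positivity
    · refine le_of_mul_le_mul_left ?_ h0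
      nlinarith [norm_nonneg u]
  | succ p ih =>
    set P := splineProj (n := n) p ((p : ℤ) - 1) with hP
    set e := volterra u - splineProj (p + 1) (((p + 1 : ℕ) : ℤ) - 1) n (volterra u) with he
    have h1 : primitive e 1 = 0 := by
      have h : inner ℝ (Lp.const 2 unitMeasure (1 : ℝ)) e = 0 :=
        inner_sub_splineProj _ (const_mem_splineSpace _ _ _ 1)
      rw [inner_eq_integral] at h
      refine Eq.trans (integral_congr_unit ?_) h
      filter_upwards [Lp.coeFn_const (p := 2) (μ := unitMeasure) (c := (1 : ℝ))] with x hx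
      rw [hx, Function.const_apply, one_mul]
    have h2 : ‖e‖ * ‖e‖ = -inner ℝ (volterra e - P (volterra e)) u := by
      have h5 : inner ℝ e (volterra u) = inner ℝ e (volterra (u - P u)) := by
        rw [volterra_sub, inner_sub_right, inner_sub_splineProj_left _
          (volterra_mem_splineSpace_succ (splineProj_mem _ _ u)), sub_zero]
      have h6 : inner ℝ (volterra e) (u - P u) = inner ℝ (volterra e - P (volterra e)) u := by
        have h7 := inner_sub_splineProj (n := n) u (splineProj_mem p ((p : ℤ) - 1) (volterra e))
        have h8 := inner_sub_splineProj_left (n := n) (volterra e)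
          (splineProj_mem p ((p : ℤ) - 1) u)
        rw [inner_sub_right] at h7 ⊢
        rw [inner_sub_left] at h8 ⊢
        linarith
      rw [← h6, ← inner_volterra_right h1, ← h5]
      exact norm_mul_self_sub_splineProj _ _ _
    have h3 := ih e
    have h4 := neg_le_of_abs_le (abs_real_inner_le_norm (volterra e - P (volterra e)) u)
    rcases (norm_nonneg e).eq_or_lt with h0 | h0
    · rw [← h0]; positivity
    · refine le_of_mul_le_mul_left ?_ h0
      nlinarith [norm_nonneg u]

theorem norm_sub_splineProj_le_of_hasWeakDeriv {p q : ℕ} (hqp : q ≤ p) {f g : L2}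
    (hf : f ∈ sobolevH (q + 1)) (hg : HasWeakDeriv (q + 1) f g) :
    ‖f - splineProj p ((p : ℤ) - 1) n f‖ ≤ (1 / (n * Real.pi)) ^ (q + 1) * ‖g‖ := by
  induction q generalizing p f with
  | zero =>
    obtain ⟨c, hc⟩ := hg.exists_eq_const_add_volterra
    refine (norm_sub_splineProj_le f (Submodule.add_mem _ (const_mem_splineSpace _ _ _ c)
      (splineProj_mem p _ (volterra g)))).trans ?_
    have h := norm_volterra_sub_splineProj_le (n := n) p g
    rwa [hc, add_sub_add_left_eq_sub, zero_add, pow_one]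
  | succ q ih =>
    obtain ⟨p, rfl⟩ : ∃ r, p = r + 1 := ⟨p - 1, by omega⟩
    obtain ⟨f₁, hf₁⟩ := hf 1 (by omega)
    have hs₁ : f₁ ∈ sobolevH (q + 1) := fun j hj => by
      obtain ⟨d, hd⟩ := hf (j + 1) (by omega)
      exact ⟨d, hf₁.of_succ hd⟩
    have h1 := ih (p := p) (by omega) hs₁ (hf₁.of_succ hg)
    obtain ⟨c, hc⟩ := hf₁.exists_eq_const_add_volterra
    set P := splineProj (n := n) p ((p : ℤ) - 1) with hP
    -- compare with the spline that matches `f` up to the residual of the primitive of `f₁ - P f₁`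
    refine (norm_sub_splineProj_le f (Submodule.add_mem _ (Submodule.add_mem _
      (const_mem_splineSpace _ _ _ c)
      (volterra_mem_splineSpace_succ (splineProj_mem p _ f₁)))
      (splineProj_mem (p + 1) _ (volterra (f₁ - P f₁))))).trans ?_
    have h2 := norm_volterra_sub_splineProj_le (n := n) (p + 1) (f₁ - P f₁)
    have h3 : ∀ z : L2, f - (Lp.const 2 unitMeasure c + volterra (P f₁) + z) =
        volterra (f₁ - P f₁) - z := by
      intro z
      rw [volterra_sub]
      conv_lhs => rw [hc]
      abel
    rw [h3]
    refine h2.trans ?_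
    rw [pow_succ', mul_assoc]
    exact mul_le_mul_of_nonneg_left h1 (by positivity)

/-! ### The best constant -/

/-- The `m`-fold primitive of `1` lies in `H^m(0,1)` and has derivative `1` of order `m`. -/
theorem exists_sobolevH_hasWeakDeriv_const (m : ℕ) :
    ∃ f ∈ sobolevH m, HasWeakDeriv m f (Lp.const 2 unitMeasure 1) := by
  induction m with
  | zero =>
    refine ⟨Lp.const 2 unitMeasure 1, fun j hj => ?_, hasWeakDeriv_zero _⟩
    obtain rfl := Nat.le_zero.1 hj
    exact ⟨_, hasWeakDeriv_zero _⟩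
  | succ m ih =>
    obtain ⟨f, hf, hg⟩ := ih
    refine ⟨volterra f, fun j hj => ?_, hg.volterra⟩
    rcases j with _ | j
    · exact ⟨_, hasWeakDeriv_zero _⟩
    · obtain ⟨d, hd⟩ := hf j (by omega)
      exact ⟨d, hd.volterra⟩

theorem nonneg_of_mem_admissibleConstants {p q : ℕ} {k : ℤ} {c : ℝ}
    (hc : c ∈ admissibleConstants p k n q) : 0 ≤ c := by
  obtain ⟨f, hf, hg⟩ := exists_sobolevH_hasWeakDeriv_const (q + 1)
  have h1 : 0 < ‖Lp.const 2 unitMeasure (1 : ℝ)‖ := by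
    rw [Lp.norm_const' _ _ _ (by simp) (by simp)]
    simp
  exact nonneg_of_mul_nonneg_left ((norm_nonneg _).trans (hc f hf _ hg)) h1

theorem isLeast_bestConstant {p q : ℕ} {k : ℤ} (h : (admissibleConstants p k n q).Nonempty) :
    IsLeast (admissibleConstants p k n q) (bestConstant p k n q) := by
  have hbdd : BddBelow (admissibleConstants p k n q) :=
    ⟨0, fun c hc => nonneg_of_mem_admissibleConstants hc⟩
  refine ⟨IsClosed.csInf_mem ?_ h hbdd, fun c hc => csInf_le hbdd hc⟩
  simp only [admissibleConstants, ofPred_forall]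
  exact isClosed_iInter fun f => isClosed_iInter fun _ => isClosed_iInter fun g =>
    isClosed_iInter fun _ => isClosed_le continuous_const (by fun_prop)

end SplineApprox

theorem mainTheorem5 (p q : ℕ) (hqp : q ≤ p) (k : ℤ) (hk : -1 ≤ k) (hkp : k ≤ (p : ℤ) - 1)
    (n : ℕ) [NeZero n] :
    IsLeast (SplineApprox.admissibleConstants p k n q) (SplineApprox.bestConstant p k n q) ∧
      SplineApprox.bestConstant p k n q ≤ (1 / ((n : ℝ) * Real.pi)) ^ (q + 1) := by
  have hmem : (1 / ((n : ℝ) * Real.pi)) ^ (q + 1) ∈ SplineApprox.admissibleConstants p k n q :=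
    fun f hf g hg => (SplineApprox.norm_sub_splineProj_le f
      (SplineApprox.splineSpace_anti p n hkp (SplineApprox.splineProj_mem p _ f))).trans
      (SplineApprox.norm_sub_splineProj_le_of_hasWeakDeriv hqp hf hg)
  have h := SplineApprox.isLeast_bestConstant ⟨_, hmem⟩
  exact ⟨h, h.2 hmem⟩
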